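/- Let $r\ge 2$, let $\Gamma_1,\dots,\Gamma_r$ be finite groups, let $H$ be a finite group with injective homomorphisms $\varphi_i:H\to\Gamma_i$, and identify $H$ with the subgroup $\varphi_i(H)$ of $\Gamma_i$. Assume that $[\Gamma_i:H]\ge 2$ for every $i$. Let $\Gamma=\Gamma_1*_H\Gamma_2*_H\cdots*_H\Gamma_r$ be the free product with amalgamation over $H$; each $\Gamma_i$ is regarded as a subgroup of $\Gamma$. Let $\mu_i$ be a probability measure on $\Gamma_i$ $(1\le i\le r)$, let $\alpha_1,\dots,\alpha_r>0$ with $\sum_i\alpha_i=1$, and let $\mu=\sum_{i=1}^r\alpha_i\mu_i$, a probability measure on $\Gamma$. Let $(X_n)_{n\ge 0}$ be the random walk on $\Gamma$ with $X_0=e$ and transition probabilities $p(x,y)=\mu(x^{-1}y)$. It is called recurrent if $\mathbb P[\exists n\ge 1: X_n=e]=1$, and transient if this probability is less than $1$. The group $\Gamma$ is called amenable if there is a left-invariant finitely additive probability measure on the set of all subsets of $\Gamma$. (a) If the support of $\mu$ generates $\Gamma$ (that is, the walk is irreducible), then the walk is recurrent if and only if $r=2$ and $[\Gamma_1:H]=[\Gamma_2:H]=2$.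 (b) If $r=2$ and $[\Gamma_1:H]=[\Gamma_2:H]=2$, then the walk is recurrent, whether or not the support of $\mu$ generates $\Gamma$. (c) If it is not the case that $r=2$ and $[\Gamma_1:H]=[\Gamma_2:H]=2$, then $\Gamma$ is non-amenable; if moreover the support of $\mu$ generates $\Gamma$, then the walk is transient. -/

import Mathlib

open scoped ENNReal Pointwise

/-- A (discrete) group is amenable if it carries a left-invariant, finitely additive
probability measure defined on all of its subsets. -/
def IsAmenableGroup (G : Type*) [Group G] : Prop :=
  ∃ m : Set G → ℝ≥0∞, m Set.univ = 1 ∧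
    (∀ s t : Set G, Disjoint s t → m (s ∪ t) = m s + m t) ∧
      ∀ (g : G) (s : Set G), m (g • s) = m s

namespace RandomWalk

variable {G : Type*} [Group G]

/-- Position at time `n` of the right random walk started at the identity with increments
`ξ 0, ξ 1, …`, that is, `X 0 = 1` and `X (n + 1) = X n * ξ n`. -/
def position (ξ : ℕ → G) : ℕ → G
  | 0 => 1
  | n + 1 => position ξ n * ξ n

/-- The law of a sequence of independent increments, each with distribution `μ`, where `G`
carries the discrete σ-algebra. For this law of the increments, `position` is a Markov chain on
`G` started at `1` with transition probabilities `p x y = μ (x⁻¹ * y)`. -/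
noncomputable def incrementLaw (μ : PMF G) : @MeasureTheory.Measure (ℕ → G)
    (@MeasurableSpace.pi ℕ (fun _ => G) (fun _ => ⊤)) :=
  letI : MeasurableSpace G := ⊤
  MeasureTheory.Measure.infinitePi (fun _ : ℕ => μ.toMeasure)

/-- The probability that the random walk with step distribution `μ`, started at the identity,
ever returns to the identity at a positive time. -/
noncomputable def returnProbability (μ : PMF G) : ℝ≥0∞ :=
  letI : MeasurableSpace G := ⊤
  incrementLaw μ {ξ : ℕ → G | ∃ n : ℕ, 1 ≤ n ∧ position ξ n = 1}

/-- The random walk with step distribution `μ` is recurrent if it returns to its starting point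
with probability one. (By left invariance the starting point does not matter.) -/
def IsRecurrent (μ : PMF G) : Prop :=
  returnProbability μ = 1

/-- The random walk with step distribution `μ` is transient if, with positive probability, it
never returns to its starting point. -/
def IsTransient (μ : PMF G) : Prop :=
  returnProbability μ < 1

end RandomWalk

/-- The step distribution `∑ i, α i * μ i` on the free product with amalgamation of the groups
`Γ i` over `H`, where every `μ i` is regarded as a measure on the amalgam through the canonical
map `Γ i → Monoid.PushoutI φ`: pick an index `i` with probability `α i`, then an element of
`Γ i` with distribution `μ i`. -/
noncomputable def amalgamStep {r : ℕ} {H : Type*} [Group H] {Γ : Fin r → Type*}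
    [∀ i, Group (Γ i)] (φ : ∀ i, H →* Γ i) (α : PMF (Fin r)) (μ : ∀ i, PMF (Γ i)) :
    PMF (Monoid.PushoutI φ) :=
  α.bind fun i => (μ i).map (Monoid.PushoutI.of i)

/-- A translate-disjointness configuration witnessing non-amenability: two left translates of `B`
cover the group, while three left translates of `B` are pairwise disjoint. -/
structure IsParadoxical {G : Type*} [Group G] (B : Set G) (x y z : G) : Prop where
  cover : ∀ w : G, w ∈ B ∨ w ∈ x • B
  disjoint_left : Disjoint B (y • B)
  disjoint_right : Disjoint B (z • B)
  disjoint_both : Disjoint (y • B) (z • B)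

namespace IsParadoxical

variable {G : Type*} [Group G] {B : Set G} {x y z : G}

theorem not_isAmenableGroup (h : IsParadoxical B x y z) : ¬ IsAmenableGroup G := by
  rintro ⟨m, hm1, hadd, hinv⟩
  have hmono : ∀ s t : Set G, s ⊆ t → m s ≤ m t := fun s t hst => by
    rw [← Set.union_sdiff_cancel hst, hadd _ _ Set.disjoint_sdiff_right]
    exact le_self_add
  have hcov : 1 ≤ m B + m B := by
    calc 1 = m (B ∪ (x • B) \ B) := by
            rw [Set.union_sdiff_self, ← hm1]
            congr 1
            exact (Set.eq_univ_of_forall h.cover).symm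
      _ = m B + m ((x • B) \ B) := hadd _ _ Set.disjoint_sdiff_right
      _ ≤ m B + m (x • B) := by gcongr; exact hmono _ _ Set.sdiff_subset
      _ = m B + m B := by rw [hinv]
  have hpack : m B + m B + m B ≤ 1 := by
    calc m B + m B + m B = m B + m (y • B) + m (z • B) := by rw [hinv, hinv]
      _ = m (B ∪ y • B ∪ z • B) := by
          rw [hadd _ _ (Set.disjoint_union_left.2 ⟨h.disjoint_right, h.disjoint_both⟩),
            hadd _ _ h.disjoint_left]
      _ ≤ 1 := hm1 ▸ hmono _ _ (Set.subset_univ _)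
  have hfin : m B ≠ ∞ := ((le_add_self.trans hpack).trans_lt ENNReal.one_lt_top).ne
  lift m B to NNReal using hfin with b
  norm_cast at hcov hpack
  have h1 : (1 : ℝ) ≤ b + b := by exact_mod_cast hcov
  have h2 : (b : ℝ) + b + b ≤ 1 := by exact_mod_cast hpack
  linarith

end IsParadoxical

/-! ### The left regular representation on square-summable functions -/

section LeftRegular

variable {G : Type*} [Group G]

theorem lp_two_hasSum_sq {ι : Type*} (v : lp (fun _ : ι => ℝ) 2) :
    HasSum (fun a => v a ^ 2) (‖v‖ ^ 2) := by
  have := lp.hasSum_inner (𝕜 := ℝ) v v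
  rw [real_inner_self_eq_norm_sq] at this
  simpa [pow_two] using this

/-- Left translation by `g` on `ℓ²(G)`. -/
noncomputable def leftShift (g : G) : lp (fun _ : G => ℝ) 2 →ₗᵢ[ℝ] lp (fun _ : G => ℝ) 2 where
  toFun v := ⟨fun a => v (g⁻¹ * a), by
    refine memℓp_gen ?_
    have := (lp_two_hasSum_sq v).summable.comp_injective (mul_right_injective g⁻¹)
    simpa [Function.comp_def] using this⟩
  map_add' _ _ := rfl
  map_smul' _ _ := rfl
  norm_map' v := by
    have h1 := lp_two_hasSum_sq v
    rw [← (Equiv.mulLeft g⁻¹).hasSum_iff] at h1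
    exact (pow_left_inj₀ (norm_nonneg _) (norm_nonneg _) two_ne_zero).1
      ((lp_two_hasSum_sq _).unique h1)

@[simp]
theorem leftShift_apply (g : G) (v : lp (fun _ : G => ℝ) 2) (a : G) :
    leftShift g v a = v (g⁻¹ * a) := rfl

theorem leftShift_mul (g h : G) (v : lp (fun _ : G => ℝ) 2) :
    leftShift (g * h) v = leftShift g (leftShift h v) := by
  ext a; simp [mul_assoc]

theorem leftShift_one (v : lp (fun _ : G => ℝ) 2) : leftShift (1 : G) v = v := by
  ext a; simp

/-- The `ℓ²`-mass carried by a set. -/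
noncomputable def lpMass {ι : Type*} (s : Set ι) (v : lp (fun _ : ι => ℝ) 2) : ℝ :=
  ∑' a, s.indicator (fun a => v a ^ 2) a

theorem summable_indicator_sq {ι : Type*} (s : Set ι) (v : lp (fun _ : ι => ℝ) 2) :
    Summable (s.indicator fun a => v a ^ 2) :=
  (lp_two_hasSum_sq v).summable.indicator s

theorem lpMass_smul (g : G) (s : Set G) (v : lp (fun _ : G => ℝ) 2) :
    lpMass (g • s) v = lpMass s (leftShift g⁻¹ v) := by
  rw [lpMass, lpMass, ← (Equiv.mulLeft g).tsum_eq]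
  congr 1 with a
  by_cases h : a ∈ s
  · rw [Set.indicator_of_mem h, Set.indicator_of_mem (show Equiv.mulLeft g a ∈ g • s from Set.smul_mem_smul_set h)]
    simp
  · rw [Set.indicator_of_notMem h, Set.indicator_of_notMem
      (show Equiv.mulLeft g a ∉ g • s from mt Set.smul_mem_smul_set_iff.1 h)]

theorem lpMass_le {ι : Type*} (s : Set ι) (v w : lp (fun _ : ι => ℝ) 2) :
    lpMass s v ≤ 11 / 10 * lpMass s w + 11 * ‖v - w‖ ^ 2 := by
  have h1 := (summable_indicator_sq s w).hasSum.mul_left (11 / 10 : ℝ)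
  have h2 := (lp_two_hasSum_sq (v - w)).mul_left (11 : ℝ)
  refine hasSum_le (fun a => ?_) (summable_indicator_sq s v).hasSum (h1.add h2)
  by_cases h : a ∈ s
  · simp only [Set.indicator_of_mem h, lp.coeFn_sub, Pi.sub_apply]
    nlinarith [sq_nonneg (10 * v a - 11 * w a)]
  · simp only [Set.indicator_of_notMem h, lp.coeFn_sub, Pi.sub_apply]
    positivity

theorem lpMass_smul_le (g : G) (s : Set G) (v : lp (fun _ : G => ℝ) 2) :
    lpMass (g • s) v ≤ 11 / 10 * lpMass s v + 11 * ‖v - leftShift g v‖ ^ 2 := by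
  rw [lpMass_smul]
  convert! lpMass_le s (leftShift g⁻¹ v) v using 3
  rw [← (leftShift g).norm_map (leftShift g⁻¹ v - v), map_sub, ← leftShift_mul, mul_inv_cancel,
    leftShift_one]

theorem lpMass_le_smul (g : G) (s : Set G) (v : lp (fun _ : G => ℝ) 2) :
    lpMass s v ≤ 11 / 10 * lpMass (g • s) v + 11 * ‖v - leftShift g v‖ ^ 2 := by
  rw [lpMass_smul]
  convert! lpMass_le s v (leftShift g⁻¹ v) using 3
  rw [← (leftShift g).norm_map (v - leftShift g⁻¹ v), map_sub, ← leftShift_mul, mul_inv_cancel,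
    leftShift_one, norm_sub_rev]

theorem IsParadoxical.norm_sq_le {B : Set G} {x y z : G} (h : IsParadoxical B x y z)
    (v : lp (fun _ : G => ℝ) 2) :
    ‖v‖ ^ 2 ≤ 110 * (‖v - leftShift x v‖ ^ 2 + ‖v - leftShift y v‖ ^ 2 +
      ‖v - leftShift z v‖ ^ 2) := by
  have hB := (summable_indicator_sq B v).hasSum
  have hcov : ‖v‖ ^ 2 ≤ lpMass B v + lpMass (x • B) v := by
    refine hasSum_le (fun a => ?_) (lp_two_hasSum_sq v)
      (hB.add (summable_indicator_sq (x • B) v).hasSum)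
    have h0 : ∀ s : Set G, 0 ≤ s.indicator (fun a => v a ^ 2) a :=
      fun s => Set.indicator_nonneg (fun _ _ => sq_nonneg _) _
    rcases h.cover a with ha | ha
    · rw [Set.indicator_of_mem ha]
      linarith [h0 (x • B)]
    · rw [Set.indicator_of_mem ha (fun a => v a ^ 2)]
      linarith [h0 B]
  have hpack : lpMass B v + lpMass (y • B) v + lpMass (z • B) v ≤ ‖v‖ ^ 2 := by
    refine hasSum_le (fun a => ?_) ((hB.add (summable_indicator_sq (y • B) v).hasSum).add
      (summable_indicator_sq (z • B) v).hasSum) (lp_two_hasSum_sq v)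
    have d1 : a ∈ B → a ∉ y • B := fun h' => Set.disjoint_left.1 h.disjoint_left h'
    have d2 : a ∈ B → a ∉ z • B := fun h' => Set.disjoint_left.1 h.disjoint_right h'
    have d3 : a ∈ y • B → a ∉ z • B := fun h' => Set.disjoint_left.1 h.disjoint_both h'
    have := sq_nonneg (v a)
    classical
    simp only [Set.indicator_apply]
    split_ifs <;> first | linarith | tauto
  have e1 := lpMass_smul_le x B v
  have e2 := lpMass_le_smul y B v
  have e3 := lpMass_le_smul z B v
  have n1 := sq_nonneg ‖v - leftShift x v‖
  have n2 := sq_nonneg ‖v - leftShift y v‖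
  have n3 := sq_nonneg ‖v - leftShift z v‖
  linarith

end LeftRegular

/-! ### First syllables in an amalgamated product -/

namespace Monoid.PushoutI

variable {ι H : Type*} {Γ : ι → Type*} [Group H] [∀ i, Group (Γ i)] {φ : ∀ i, H →* Γ i}

open scoped Classical in
/-- The index of the first syllable of the normal form of `g`, if there is one. -/
noncomputable def firstIndex (d : NormalWord.Transversal φ) (g : PushoutI φ) : Option ι :=
  (g • (NormalWord.empty : NormalWord d)).fstIdx

theorem firstIndex_of_mul {d : NormalWord.Transversal φ} {i : ι} {x : Γ i}
    (hx : x ∉ (φ i).range) {w : PushoutI φ} (hw : firstIndex d w ≠ some i) :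
    firstIndex d (of i x * w) = some i := by
  classical
  unfold firstIndex at *
  rw [mul_smul, ← NormalWord.cons_eq_smul x _ (by convert! hw) hx]
  simp [NormalWord.cons, CoprodI.Word.fstIdx, CoprodI.Word.cons]

theorem exists_isParadoxical (hφ : ∀ i, Function.Injective (φ i)) {i j k : ι} (hj : j ≠ i)
    (hk : k ≠ i) {x : Γ i} (hx : x ∉ (φ i).range) {y : Γ j} (hy : y ∉ (φ j).range)
    {z : Γ k} (hz : z ∉ (φ k).range)
    (hyz : j ≠ k ∨ ∃ u : Γ k, u ∉ (φ k).range ∧ (of j y : PushoutI φ)⁻¹ * of k z = of k u) :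
    ∃ (B : Set (PushoutI φ)) (x y z : PushoutI φ), IsParadoxical B x y z := by
  obtain ⟨d⟩ := NormalWord.transversal_nonempty φ hφ
  let B : Set (PushoutI φ) := {w | firstIndex d w = none ∨ firstIndex d w = some i}
  have hB : ∀ {l : ι} (_ : l ≠ i) {w}, w ∈ B → firstIndex d w ≠ some l := by
    rintro l hl w (h | h) h'
    · simp [h] at h'
    · exact hl (Option.some_injective _ (h'.symm.trans h))
  have hB' : ∀ {l : ι} (_ : l ≠ i) {u : Γ l} (_ : u ∉ (φ l).range) {w},
      w ∈ (of l u : PushoutI φ) • B → firstIndex d w = some l := by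
    rintro l hl u hu w ⟨b, hb, rfl⟩
    exact firstIndex_of_mul hu (hB hl hb)
  have hdisj : ∀ {l : ι} (_ : l ≠ i) {u : Γ l} (_ : u ∉ (φ l).range),
      Disjoint B ((of l u : PushoutI φ) • B) := fun hl _ hu =>
    Set.disjoint_left.2 fun w hw hw' => hB hl hw (hB' hl hu hw')
  refine ⟨B, of i x, of j y, of k z, fun w => ?_, hdisj hj hy, hdisj hk hz, ?_⟩
  · by_cases hw : firstIndex d w = some i
    · exact Or.inl (Or.inr hw)
    · refine Or.inr (Set.mem_smul_set_iff_inv_smul_mem.2 (Or.inr ?_))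
      rw [← map_inv]
      exact firstIndex_of_mul (by simpa using hx) hw
  · rcases hyz with hjk | ⟨u, hu, huz⟩
    · exact Set.disjoint_left.2 fun w hw hw' =>
        hjk (Option.some_injective _ ((hB' hj hy hw).symm.trans (hB' hk hz hw')))
    · rw [← Set.disjoint_smul_set (a := (of j y : PushoutI φ)⁻¹), smul_smul, smul_smul,
        inv_mul_cancel, one_smul, huz]
      exact hdisj hk hu

theorem exists_isParadoxical_of_not_dihedral {r : ℕ} (hr : 2 ≤ r) {H : Type*} [Group H]
    {Γ : Fin r → Type*} [∀ i, Group (Γ i)] {φ : ∀ i, H →* Γ i}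
    (hφ : ∀ i, Function.Injective (φ i)) (hindex : ∀ i, 2 ≤ (φ i).range.index)
    (h : ¬ (r = 2 ∧ ∀ i, (φ i).range.index = 2)) :
    ∃ (B : Set (PushoutI φ)) (x y z : PushoutI φ), IsParadoxical B x y z := by
  have hne : ∀ i, ∃ x : Γ i, x ∉ (φ i).range := fun i => by
    by_contra! hall
    have := (φ i).range.index_eq_one.2 (eq_top_iff.2 fun x _ => hall x)
    have := hindex i
    omega
  choose x hx using hne
  by_cases hr2 : r = 2
  · subst hr2
    obtain ⟨j, hj⟩ : ∃ j, (φ j).range.index ≠ 2 := not_forall.1 fun hall => h ⟨rfl, hall⟩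
    obtain ⟨i, hi⟩ : ∃ i, i ≠ j := exists_ne j
    obtain ⟨z, hz⟩ : ∃ z, z ∉ (φ j).range ∧ (x j)⁻¹ * z ∉ (φ j).range := by
      by_contra! hall
      refine hj (Subgroup.index_eq_two_iff_exists_notMem_and'.2 ⟨(x j)⁻¹, by simpa using hx j, ?_⟩)
      intro b
      by_cases hb : b ∈ (φ j).range
      · exact Or.inr hb
      · exact Or.inl (hall b hb)
    exact exists_isParadoxical hφ hi.symm hi.symm (hx i) (hx j) hz.1
      (Or.inr ⟨_, hz.2, by simp⟩)
  · exact exists_isParadoxical hφ (i := ⟨0, by omega⟩) (j := ⟨1, by omega⟩) (k := ⟨2, by omega⟩)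
      (by simp) (by simp) (hx _) (hx _) (hx _) (Or.inl (by simp))

end Monoid.PushoutI

/-! ### Convolution powers -/

namespace RandomWalk

variable {G : Type*} [Group G]

/-- The law of the product of `n` independent elements with distribution `μ`. -/
noncomputable def stepPower (μ : PMF G) : ℕ → PMF G
  | 0 => PMF.pure 1
  | n + 1 => μ.bind fun g => (stepPower μ n).map (g * ·)

theorem map_mul_left_apply (p : PMF G) (g x : G) : p.map (g * ·) x = p (g⁻¹ * x) := by
  classical
  rw [PMF.map_apply, tsum_eq_single (g⁻¹ * x)]
  · simp
  · intro y hy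
    rw [if_neg]
    rintro rfl
    simp at hy

theorem stepPower_succ_apply (μ : PMF G) (n : ℕ) (x : G) :
    stepPower μ (n + 1) x = ∑' g, μ g * stepPower μ n (g⁻¹ * x) := by
  simp only [stepPower, PMF.bind_apply, map_mul_left_apply]

theorem stepPower_add (μ : PMF G) (m n : ℕ) :
    stepPower μ (m + n) = (stepPower μ m).bind fun g => (stepPower μ n).map (g * ·) := by
  induction m with
  | zero => simpa [stepPower] using! (PMF.map_id _).symm
  | succ m ih =>
    rw [Nat.succ_add, stepPower, ih, stepPower, PMF.bind_bind]
    congr 1 with g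
    simp only [PMF.map_bind, PMF.bind_map, PMF.map_comp, Function.comp_def, mul_assoc]

theorem stepPower_add_apply (μ : PMF G) (m n : ℕ) (x : G) :
    stepPower μ (m + n) x = ∑' g, stepPower μ m g * stepPower μ n (g⁻¹ * x) := by
  simp only [stepPower_add, PMF.bind_apply, map_mul_left_apply]

theorem mul_stepPower_le (μ : PMF G) (m n : ℕ) (x y : G) :
    stepPower μ m x * stepPower μ n y ≤ stepPower μ (m + n) (x * y) := by
  rw [stepPower_add_apply]
  refine le_trans ?_ (ENNReal.le_tsum x)
  simp

theorem stepPower_one (μ : PMF G) : stepPower μ 1 = μ := by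
  simp only [stepPower, PMF.pure_map, mul_one, PMF.bind_pure]

theorem stepPower_map {K : Type*} [Group K] (f : G →* K) (μ : PMF G) (n : ℕ) :
    stepPower (μ.map f) n = (stepPower μ n).map f := by
  induction n with
  | zero => simp [stepPower, PMF.pure_map]
  | succ n ih =>
    simp only [stepPower, PMF.map_bind, PMF.bind_map, ih, PMF.map_comp, Function.comp_def, map_mul]

/-! ### Bounded Green function from an `ℓ²` spectral gap -/

theorem sum_toReal_eq_one {ι : Type*} (μ : PMF ι) (hfin : μ.support.Finite) :
    ∑ g ∈ hfin.toFinset, (μ g).toReal = 1 := by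
  rw [← ENNReal.toReal_sum (fun g _ => μ.apply_ne_top g), ← ENNReal.toReal_one, ← μ.tsum_coe,
    tsum_eq_sum fun g hg => ?_]
  simpa using hg

/-- Convolution by a finitely supported probability measure, acting on `ℓ²(G)`. -/
noncomputable def markovOp (μ : PMF G) (hfin : μ.support.Finite)
    (v : lp (fun _ : G => ℝ) 2) : lp (fun _ : G => ℝ) 2 :=
  ∑ g ∈ hfin.toFinset, (μ g).toReal • leftShift g v

theorem markovOp_sum (μ : PMF G) (hfin : μ.support.Finite) (N : ℕ)
    (v : ℕ → lp (fun _ : G => ℝ) 2) :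
    markovOp μ hfin (∑ n ∈ Finset.range N, v n) = ∑ n ∈ Finset.range N, markovOp μ hfin (v n) := by
  simp only [markovOp, map_sum, Finset.smul_sum]
  exact Finset.sum_comm

/-- The quadratic form of `1 - markovOp μ`. -/
noncomputable def dirichletForm (μ : PMF G) (hfin : μ.support.Finite)
    (v : lp (fun _ : G => ℝ) 2) : ℝ :=
  ‖v‖ ^ 2 - inner ℝ (markovOp μ hfin v) v

theorem dirichletForm_eq (μ : PMF G) (hfin : μ.support.Finite) (v : lp (fun _ : G => ℝ) 2) :
    2 * dirichletForm μ hfin v =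
      ∑ g ∈ hfin.toFinset, (μ g).toReal * ‖v - leftShift g v‖ ^ 2 := by
  have : ∀ g : G, ‖v - leftShift g v‖ ^ 2 = 2 * (‖v‖ ^ 2 - inner ℝ (leftShift g v) v) := fun g => by
    rw [norm_sub_sq_real, (leftShift g).norm_map, real_inner_comm]; ring
  simp only [this, dirichletForm, markovOp, sum_inner, real_inner_smul_left]
  conv_lhs => rw [← one_mul (‖v‖ ^ 2), ← sum_toReal_eq_one μ hfin, Finset.sum_mul,
    ← Finset.sum_sub_distrib, Finset.mul_sum]
  exact Finset.sum_congr rfl fun g _ => by ring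

theorem exists_norm_sub_leftShift_le (μ : PMF G) (hfin : μ.support.Finite)
    (hgen : Subgroup.closure μ.support = ⊤) (x : G) :
    ∃ C : ℝ, 0 ≤ C ∧ ∀ v, ‖v - leftShift x v‖ ^ 2 ≤ C * dirichletForm μ hfin v := by
  have hx : x ∈ Subgroup.closure μ.support := hgen ▸ Subgroup.mem_top x
  have hnn : ∀ v, 0 ≤ dirichletForm μ hfin v := fun v => by
    have := dirichletForm_eq μ hfin v
    have : 0 ≤ 2 * dirichletForm μ hfin v := this ▸ Finset.sum_nonneg fun g _ => by positivity
    linarith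
  induction hx using Subgroup.closure_induction with
  | mem g hg =>
    have hpos : 0 < (μ g).toReal := ENNReal.toReal_pos hg (μ.apply_ne_top g)
    refine ⟨2 / (μ g).toReal, by positivity, fun v => ?_⟩
    have h1 : (μ g).toReal * ‖v - leftShift g v‖ ^ 2 ≤ 2 * dirichletForm μ hfin v := by
      rw [dirichletForm_eq]
      exact Finset.single_le_sum (f := fun g => (μ g).toReal * ‖v - leftShift g v‖ ^ 2)
        (fun _ _ => by positivity) (hfin.mem_toFinset.2 hg)
    rw [div_mul_eq_mul_div, le_div_iff₀ hpos]
    linarith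
  | one => exact ⟨0, le_rfl, fun v => by simp [leftShift_one]⟩
  | mul x y _ _ hx hy =>
    obtain ⟨C, hC, hCv⟩ := hx
    obtain ⟨D, hD, hDv⟩ := hy
    refine ⟨2 * C + 2 * D, by positivity, fun v => ?_⟩
    have h1 : ‖v - leftShift (x * y) v‖ ≤ ‖v - leftShift x v‖ + ‖v - leftShift y v‖ := by
      rw [leftShift_mul, ← (leftShift x).norm_map (v - leftShift y v), map_sub]
      exact norm_sub_le_norm_sub_add_norm_sub _ _ _
    have h2 := norm_nonneg (v - leftShift (x * y) v)
    nlinarith [sq_nonneg (‖v - leftShift x v‖ - ‖v - leftShift y v‖), hCv v, hDv v]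
  | inv x _ hx =>
    obtain ⟨C, hC, hCv⟩ := hx
    refine ⟨C, hC, fun v => ?_⟩
    rw [← (leftShift x).norm_map, map_sub, ← leftShift_mul, mul_inv_cancel, leftShift_one,
      norm_sub_rev]
    exact hCv v

/-- The convolution powers as vectors of `ℓ²(G)`. -/
noncomputable def powerVec (μ : PMF G) (hfin : μ.support.Finite) : ℕ → lp (fun _ : G => ℝ) 2
  | 0 => open scoped Classical in lp.single 2 1 (1 : ℝ)
  | n + 1 => markovOp μ hfin (powerVec μ hfin n)

theorem powerVec_apply (μ : PMF G) (hfin : μ.support.Finite) (n : ℕ) (x : G) :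
    powerVec μ hfin n x = (stepPower μ n x).toReal := by
  classical
  induction n generalizing x with
  | zero =>
    by_cases hx : x = 1 <;> simp [powerVec, stepPower, PMF.pure_apply, hx]
  | succ n ih =>
    rw [stepPower_succ_apply, tsum_eq_sum (s := hfin.toFinset), ENNReal.toReal_sum]
    · simp only [powerVec, markovOp, lp.coeFn_sum, Finset.sum_apply, lp.coeFn_smul, Pi.smul_apply,
        leftShift_apply, ih, ENNReal.toReal_mul, smul_eq_mul]
    · exact fun g _ => ENNReal.mul_ne_top (μ.apply_ne_top g) ((stepPower μ n).apply_ne_top _)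
    · intro g hg
      have : μ g = 0 := by simpa using hg
      simp [this]

theorem tsum_stepPower_one_lt_top {B : Set G} {x y z : G} (hB : IsParadoxical B x y z)
    (μ : PMF G) (hfin : μ.support.Finite) (hgen : Subgroup.closure μ.support = ⊤) :
    ∑' n, stepPower μ n 1 < ∞ := by
  classical
  obtain ⟨a, ha, hav⟩ := exists_norm_sub_leftShift_le μ hfin hgen x
  obtain ⟨b, hb, hbv⟩ := exists_norm_sub_leftShift_le μ hfin hgen y
  obtain ⟨c, hc, hcv⟩ := exists_norm_sub_leftShift_le μ hfin hgen z
  set C := 110 * (a + b + c) with hC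
  have hgap : ∀ v, ‖v‖ ^ 2 ≤ C * dirichletForm μ hfin v := fun v => by
    have := hB.norm_sq_le v
    rw [hC]
    linarith [hav v, hbv v, hcv v]
  refine lt_of_le_of_lt (ENNReal.tsum_le_of_sum_range_le (c := ENNReal.ofReal C) fun N => ?_)
    ENNReal.ofReal_lt_top
  set f := ∑ n ∈ Finset.range N, powerVec μ hfin n with hf
  have hPf : markovOp μ hfin f = f - powerVec μ hfin 0 + powerVec μ hfin N := by
    have h1 := Finset.sum_range_succ' (powerVec μ hfin) N
    rw [Finset.sum_range_succ, ← hf] at h1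
    have h2 : markovOp μ hfin f = ∑ n ∈ Finset.range N, powerVec μ hfin (n + 1) := by
      rw [hf, markovOp_sum]; rfl
    rw [h2, eq_sub_of_add_eq h1.symm]
    abel
  have hnn : 0 ≤ inner ℝ (powerVec μ hfin N) f := by
    rw [lp.inner_eq_tsum]
    refine tsum_nonneg fun g => ?_
    simp only [hf, lp.coeFn_sum, Finset.sum_apply, powerVec_apply, RCLike.inner_apply, conj_trivial]
    exact mul_nonneg (Finset.sum_nonneg fun _ _ => ENNReal.toReal_nonneg) ENNReal.toReal_nonneg
  have hdir : dirichletForm μ hfin f ≤ f 1 := by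
    rw [dirichletForm, hPf, inner_add_left, inner_sub_left, real_inner_self_eq_norm_sq]
    have : inner ℝ (powerVec μ hfin 0) f = f 1 := by
      simp [powerVec, lp.inner_single_left]
    linarith
  have hle : f 1 ≤ ‖f‖ := (le_abs_self _).trans (lp.norm_apply_le_norm two_ne_zero f 1)
  have hC0 : 0 ≤ C := by positivity
  have hCf : f 1 ≤ C := by
    have h1 : ‖f‖ ^ 2 ≤ C * ‖f‖ :=
      (hgap f).trans (mul_le_mul_of_nonneg_left (hdir.trans hle) hC0)
    rcases (norm_nonneg f).eq_or_lt with h0 | h0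
    · linarith
    · refine hle.trans (le_of_mul_le_mul_right ?_ h0)
      linarith
  have hf1 : f 1 = ∑ n ∈ Finset.range N, (stepPower μ n 1).toReal := by
    simp only [hf, lp.coeFn_sum, Finset.sum_apply, powerVec_apply]
  rw [← ENNReal.ofReal_toReal (ENNReal.sum_ne_top.2 fun n _ => (stepPower μ n).apply_ne_top 1),
    ENNReal.toReal_sum fun n _ => (stepPower μ n).apply_ne_top 1, ← hf1]
  exact ENNReal.ofReal_le_ofReal hCf

end RandomWalk

/-! ### The renewal equation -/

namespace RandomWalk

open MeasureTheory

section Splice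

variable {G : Type*}

/-- The sequence that follows `p.1` up to time `k` and continues with `p.2`. -/
def splice (k : ℕ) (p : (ℕ → G) × (ℕ → G)) (i : ℕ) : G :=
  if i < k then p.1 i else p.2 (i - k)

variable [MeasurableSpace G]

theorem measurable_splice (k : ℕ) : Measurable (splice (G := G) k) := by
  refine measurable_pi_lambda _ fun i => ?_
  unfold splice
  split_ifs <;> fun_prop

theorem map_splice (ρ : Measure G) [IsProbabilityMeasure ρ] (k : ℕ) :
    ((Measure.infinitePi fun _ : ℕ => ρ).prod (Measure.infinitePi fun _ : ℕ => ρ)).map (splice k) =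
      Measure.infinitePi fun _ : ℕ => ρ := by
  refine Measure.eq_infinitePi _ fun s t ht => ?_
  have hpre : splice k ⁻¹' Set.pi s t = Set.pi (s.filter (· < k)) t ×ˢ
      Set.pi ((s.filter (¬ · < k)).image (· - k)) fun j => t (j + k) := by
    ext p
    simp only [Set.mem_preimage, Set.mem_pi, Set.mem_prod, Finset.coe_filter, Finset.coe_image,
      Set.mem_ofPred_eq, Set.mem_image, splice, SetLike.mem_coe]
    constructor
    · refine fun h => ⟨fun i hi => by simpa [hi.2] using h i hi.1, ?_⟩
      rintro _ ⟨i, hi, rfl⟩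
      have := h i hi.1
      rwa [if_neg hi.2, ← Nat.sub_add_cancel (not_lt.1 hi.2), Nat.add_sub_cancel] at this
    · rintro ⟨h1, h2⟩ i hi
      by_cases hik : i < k
      · simpa [hik] using h1 i ⟨hi, hik⟩
      · have := h2 _ ⟨i, ⟨hi, hik⟩, rfl⟩
        rw [if_neg hik]
        rwa [Nat.sub_add_cancel (not_lt.1 hik)] at this
  rw [Measure.map_apply (measurable_splice k)
      (MeasurableSet.pi s.countable_toSet fun i _ => ht i), hpre, Measure.prod_prod,
    Measure.infinitePi_pi _ fun i _ => ht i, Measure.infinitePi_pi _ fun i _ => ht _,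
    Finset.prod_image, ← Finset.prod_filter_mul_prod_filter_not s (· < k)]
  · congr 1
    refine Finset.prod_congr rfl fun i hi => ?_
    rw [Nat.sub_add_cancel (not_lt.1 (Finset.mem_filter.1 hi).2)]
  · intro i hi j hj hij
    have hi' := (Finset.mem_filter.1 hi).2
    have hj' := (Finset.mem_filter.1 hj).2
    simp only at hij
    omega

theorem infinitePi_inter_shift (ρ : Measure G) [IsProbabilityMeasure ρ] (k : ℕ)
    {A E : Set (ℕ → G)} (hA : MeasurableSet A) (hE : MeasurableSet E)
    (hAk : ∀ p, splice k p ∈ A ↔ p.1 ∈ A) :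
    (Measure.infinitePi fun _ : ℕ => ρ) (A ∩ {ξ | (fun i => ξ (i + k)) ∈ E}) =
      (Measure.infinitePi fun _ : ℕ => ρ) A * (Measure.infinitePi fun _ : ℕ => ρ) E := by
  have hE' : MeasurableSet {ξ : ℕ → G | (fun i => ξ (i + k)) ∈ E} :=
    (show Measurable fun (ξ : ℕ → G) i => ξ (i + k) by fun_prop) hE
  conv_lhs => rw [← map_splice ρ k, Measure.map_apply (measurable_splice k) (hA.inter hE')]
  rw [← Measure.prod_prod]
  congr 1
  ext p
  have : (fun i => splice k p (i + k)) = p.2 := by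
    ext i; simp [splice]
  simp [hAk, this]

end Splice

section Position

variable {G : Type*} [Group G]

theorem position_add (ξ : ℕ → G) (k m : ℕ) :
    position ξ (k + m) = position ξ k * position (fun i => ξ (i + k)) m := by
  induction m with
  | zero => simp [position]
  | succ m ih => rw [← add_assoc, position, ih, position, mul_assoc, add_comm m k]

theorem position_congr {ξ η : ℕ → G} {n : ℕ} (h : ∀ i < n, ξ i = η i) :
    position ξ n = position η n := by
  induction n with
  | zero => rfl
  | succ n ih => rw [position, position, ih fun i hi => h i (hi.trans n.lt_succ_self), h n (by simp)]

theorem position_splice {k n : ℕ} (h : n ≤ k) (p : (ℕ → G) × (ℕ → G)) :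
    position (splice k p) n = position p.1 n :=
  position_congr fun i hi => by simp [splice, hi.trans_le h]

/-- The increment sequences for which the walk first returns to the identity at time `n + 1`. -/
def firstReturn (G : Type*) [Group G] (n : ℕ) : Set (ℕ → G) :=
  {ξ | position ξ (n + 1) = 1 ∧ ∀ m < n, position ξ (m + 1) ≠ 1}

theorem pairwise_disjoint_firstReturn : Pairwise (Function.onFun Disjoint (firstReturn G)) := by
  have : ∀ {m n}, m < n → Disjoint (firstReturn G m) (firstReturn G n) := fun hmn =>
    Set.disjoint_left.2 fun ξ hm hn => hn.2 _ hmn hm.1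
  intro m n hmn
  rcases lt_or_gt_of_ne hmn with h | h
  · exact this h
  · exact (this h).symm

theorem exists_mem_firstReturn {ξ : ℕ → G} {n : ℕ} (h : position ξ (n + 1) = 1) :
    ∃ k ≤ n, ξ ∈ firstReturn G k := by
  classical
  have hex : ∃ n, position ξ (n + 1) = 1 := ⟨n, h⟩
  exact ⟨Nat.find hex, Nat.find_min' hex h, Nat.find_spec hex, fun m hm => Nat.find_min hex hm⟩

variable [MeasurableSpace G] [DiscreteMeasurableSpace G] [Countable G]

theorem measurable_position (n : ℕ) : Measurable fun ξ : ℕ → G => position ξ n := by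
  induction n with
  | zero => exact measurable_const
  | succ n ih => exact ih.mul (measurable_pi_apply n)

theorem measurableSet_position_eq (n : ℕ) (x : G) :
    MeasurableSet {ξ : ℕ → G | position ξ n = x} :=
  measurable_position n (MeasurableSet.singleton x)

theorem measurableSet_firstReturn (n : ℕ) : MeasurableSet (firstReturn G n) := by
  have : firstReturn G n = {ξ : ℕ → G | position ξ (n + 1) = 1} ∩
      ⋂ m, ⋂ _ : m < n, {ξ : ℕ → G | position ξ (m + 1) = 1}ᶜ := by
    ext ξ; simp [firstReturn]
  rw [this]
  exact (measurableSet_position_eq (n + 1) 1).inter <| MeasurableSet.iInter fun m =>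
    MeasurableSet.iInter fun _ => (measurableSet_position_eq (m + 1) (1 : G)).compl

theorem infinitePi_position_eq (μ : PMF G) (n : ℕ) (x : G) :
    (Measure.infinitePi fun _ : ℕ => μ.toMeasure) {ξ | position ξ n = x} = stepPower μ n x := by
  induction n generalizing x with
  | zero =>
    by_cases hx : x = 1
    · subst hx; simp [position, stepPower]
    · simp [position, stepPower, hx, Ne.symm hx]
  | succ n ih =>
    have hset : {ξ : ℕ → G | position ξ (n + 1) = x} =
        ⋃ g : G, ((fun ξ : ℕ → G => ξ 0) ⁻¹' {g}) ∩
          {ξ | (fun i => ξ (i + 1)) ∈ {η : ℕ → G | position η n = g⁻¹ * x}} := by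
      ext ξ
      have : position ξ (n + 1) = ξ 0 * position (fun i => ξ (i + 1)) n := by
        rw [add_comm, position_add]; simp [position]
      simp [this, eq_inv_mul_iff_mul_eq]
    rw [hset, measure_iUnion, stepPower_succ_apply]
    · congr 1 with g
      rw [infinitePi_inter_shift _ _ (measurable_pi_apply 0 (MeasurableSet.singleton g))
        (measurableSet_position_eq n _) fun p => by simp [splice], ih,
        (measurePreserving_eval_infinitePi (fun _ : ℕ => μ.toMeasure) 0).measure_preimage
          (MeasurableSet.singleton g).nullMeasurableSet,
        PMF.toMeasure_apply_singleton _ _ (MeasurableSet.singleton g)]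
    · intro g h hgh
      exact Set.disjoint_left.2 fun ξ h1 h2 => hgh (h1.1.symm.trans h2.1)
    · exact fun g => (measurable_pi_apply 0 (MeasurableSet.singleton g)).inter
        ((show Measurable fun (ξ : ℕ → G) i => ξ (i + 1) by fun_prop)
          (measurableSet_position_eq n _))

theorem stepPower_succ_eq_sum_firstReturn (μ : PMF G) (n : ℕ) :
    stepPower μ (n + 1) 1 = ∑ p ∈ Finset.HasAntidiagonal.antidiagonal n,
      (Measure.infinitePi fun _ : ℕ => μ.toMeasure) (firstReturn G p.1) * stepPower μ p.2 1 := by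
  have hset : {ξ : ℕ → G | position ξ (n + 1) = 1} = ⋃ p ∈ Finset.HasAntidiagonal.antidiagonal n,
      firstReturn G p.1 ∩
        {ξ | (fun i => ξ (i + (p.1 + 1))) ∈ {η : ℕ → G | position η p.2 = 1}} := by
    ext ξ
    simp only [Set.mem_ofPred_eq, Set.mem_iUnion, Set.mem_inter_iff, Finset.HasAntidiagonal.mem_antidiagonal,
      exists_prop, Prod.exists]
    constructor
    · intro h
      obtain ⟨k, hk, hξ⟩ := exists_mem_firstReturn h
      refine ⟨k, n - k, Nat.add_sub_cancel' hk, hξ, ?_⟩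
      rwa [show n + 1 = (k + 1) + (n - k) by omega, position_add, hξ.1, one_mul] at h
    · rintro ⟨k, m, rfl, hξ, h⟩
      rw [show k + m + 1 = (k + 1) + m by omega, position_add, hξ.1, h, one_mul]
  rw [← infinitePi_position_eq, hset, measure_biUnion_finset]
  · refine Finset.sum_congr rfl fun p _ => ?_
    rw [infinitePi_inter_shift _ _ (measurableSet_firstReturn _) (measurableSet_position_eq _ _),
      infinitePi_position_eq]
    intro q
    simp only [firstReturn, Set.mem_ofPred_eq, position_splice le_rfl]
    refine and_congr_right fun _ => forall₂_congr fun m hm => ?_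
    rw [position_splice (by omega)]
  · intro p hp q hq hpq
    have hne : p.1 ≠ q.1 := fun h => hpq (Prod.ext h (by
      have h1 := Finset.HasAntidiagonal.mem_antidiagonal.1 hp
      have h2 := Finset.HasAntidiagonal.mem_antidiagonal.1 hq
      omega))
    exact (pairwise_disjoint_firstReturn hne).mono Set.inter_subset_left Set.inter_subset_left
  · exact fun p _ => (measurableSet_firstReturn _).inter
      ((show Measurable fun (ξ : ℕ → G) i => ξ (i + (p.1 + 1)) by fun_prop)
        (measurableSet_position_eq _ _))

theorem infinitePi_exists_return_eq_tsum (μ : PMF G) :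
    (Measure.infinitePi fun _ : ℕ => μ.toMeasure) {ξ | ∃ n, 1 ≤ n ∧ position ξ n = 1} =
      ∑' n, (Measure.infinitePi fun _ : ℕ => μ.toMeasure) (firstReturn G n) := by
  rw [← measure_iUnion pairwise_disjoint_firstReturn measurableSet_firstReturn]
  congr 1
  ext ξ
  simp only [Set.mem_ofPred_eq, Set.mem_iUnion]
  constructor
  · rintro ⟨n, hn, h⟩
    obtain ⟨m, rfl⟩ := Nat.exists_eq_add_of_le' hn
    obtain ⟨k, -, hk⟩ := exists_mem_firstReturn h
    exact ⟨k, hk⟩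
  · rintro ⟨k, hk⟩
    exact ⟨k + 1, by simp, hk.1⟩

end Position

theorem ENNReal_tsum_sum_antidiagonal (f u : ℕ → ℝ≥0∞) :
    ∑' n, ∑ p ∈ Finset.HasAntidiagonal.antidiagonal n, f p.1 * u p.2 = (∑' n, f n) * ∑' n, u n := by
  calc ∑' n, ∑ p ∈ Finset.HasAntidiagonal.antidiagonal n, f p.1 * u p.2
      = ∑' n, ∑' p : Finset.HasAntidiagonal.antidiagonal n, f p.1.1 * u p.1.2 := by
        congr 1 with n
        rw [← Finset.sum_coe_sort, tsum_fintype]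
    _ = ∑' q : Σ n : ℕ, Finset.HasAntidiagonal.antidiagonal n, f q.2.1.1 * u q.2.1.2 :=
        (ENNReal.tsum_sigma' fun q : Σ n : ℕ, Finset.HasAntidiagonal.antidiagonal n =>
          f q.2.1.1 * u q.2.1.2).symm
    _ = ∑' p : ℕ × ℕ, f p.1 * u p.2 :=
        (Finset.HasAntidiagonal.sigmaAntidiagonalEquivProd (A := ℕ)).tsum_eq fun p => f p.1 * u p.2
    _ = (∑' n, f n) * ∑' n, u n := by
        rw [ENNReal.tsum_prod (f := fun m n => f m * u n), ← ENNReal.tsum_mul_right]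
        simp_rw [← ENNReal.tsum_mul_left]

/-- A walk on a countable group is recurrent if and only if its Green function is infinite. -/
theorem isRecurrent_iff {G : Type*} [Group G] [Countable G] (μ : PMF G) :
    IsRecurrent μ ↔ ∑' n, stepPower μ n 1 = ∞ := by
  let _ : MeasurableSpace G := ⊤
  have : DiscreteMeasurableSpace G := ⟨fun _ => trivial⟩
  set f : ℕ → ℝ≥0∞ := fun n =>
    (Measure.infinitePi fun _ : ℕ => μ.toMeasure) (firstReturn G n) with hf
  set u : ℕ → ℝ≥0∞ := fun n => stepPower μ n 1 with hu
  have hu0 : u 0 = 1 := by simp [hu, stepPower]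
  have hF : returnProbability μ = ∑' n, f n := infinitePi_exists_return_eq_tsum μ
  have hren : ∀ n, u (n + 1) = ∑ p ∈ Finset.HasAntidiagonal.antidiagonal n, f p.1 * u p.2 :=
    stepPower_succ_eq_sum_firstReturn μ
  have hF1 : ∑' n, f n ≤ 1 := hF ▸ prob_le_one (μ := Measure.infinitePi fun _ : ℕ => μ.toMeasure)
  rw [IsRecurrent, hF]
  constructor
  · intro h1
    by_contra hfin
    have hU : ∑' n, u n = 1 + ∑' n, u n := by
      conv_lhs => rw [tsum_eq_zero_add' ENNReal.summable, hu0]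
      simp_rw [hren]
      rw [ENNReal_tsum_sum_antidiagonal, h1, one_mul]
    have h2 : (0 : ℝ≥0∞) + ∑' n, u n = 1 + ∑' n, u n := by rwa [zero_add]
    exact zero_ne_one ((ENNReal.add_left_inj hfin).1 h2)
  · intro hU
    by_contra hne
    have hlt : ∑' n, f n < 1 := lt_of_le_of_ne hF1 hne
    have hbound : ∀ N, ∑ n ∈ Finset.range N, u n ≤ (1 - ∑' n, f n)⁻¹ := fun N => by
      set w : ℕ → ℝ≥0∞ := fun n => if n < N then u n else 0 with hw
      have hwu : ∀ n, w n ≤ u n := fun n => by simp only [hw]; split_ifs <;> simp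
      have hsum : ∑' n, w n = ∑ n ∈ Finset.range N, u n := by
        rw [tsum_eq_sum (s := Finset.range N) fun n hn => if_neg (by simpa using hn)]
        exact Finset.sum_congr rfl fun n hn => if_pos (Finset.mem_range.1 hn)
      have hfin : ∑' n, w n ≠ ∞ := hsum ▸ ENNReal.sum_ne_top.2 fun n _ =>
        (stepPower μ n).apply_ne_top 1
      have hle : ∑' n, w n ≤ 1 + (∑' n, f n) * ∑' n, w n := by
        conv_lhs => rw [tsum_eq_zero_add' ENNReal.summable]
        rw [← ENNReal_tsum_sum_antidiagonal]
        refine add_le_add ((hwu 0).trans hu0.le) (ENNReal.tsum_le_tsum fun n => ?_)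
        by_cases hn : n + 1 < N
        · rw [show w (n + 1) = u (n + 1) from if_pos hn, hren]
          refine Finset.sum_le_sum fun p hp => ?_
          have := Finset.HasAntidiagonal.mem_antidiagonal.1 hp
          rw [show w p.2 = u p.2 from if_pos (by omega)]
        · simp [hw, hn]
      rw [← hsum, ← one_div, ENNReal.le_div_iff_mul_le
        (Or.inl (tsub_pos_of_lt hlt).ne') (Or.inl (by simp)), mul_comm, ENNReal.sub_mul
        (fun _ _ => hfin), one_mul, tsub_le_iff_right]
      exact hle
    have := ENNReal.tsum_le_of_sum_range_le hbound
    rw [hU, top_le_iff, ENNReal.inv_eq_top] at this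
    exact (tsub_pos_of_lt hlt).ne' this

theorem isTransient_iff_not_isRecurrent {G : Type*} [Group G] (μ : PMF G) :
    IsTransient μ ↔ ¬ IsRecurrent μ := by
  let _ : MeasurableSpace G := ⊤
  exact lt_iff_le_and_ne.trans (and_iff_right
    (prob_le_one (μ := Measure.infinitePi fun _ : ℕ => μ.toMeasure)))

end RandomWalk

/-! ### Recurrence of dihedral walks -/

namespace RandomWalk

section Dihedral

variable {G : Type*} [Group G]

theorem stepPower_inv {ν : PMF G} (hν : ∀ x, ν x⁻¹ = ν x) (n : ℕ) (x : G) :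
    stepPower ν n x⁻¹ = stepPower ν n x := by
  induction n generalizing x with
  | zero => by_cases hx : x = 1 <;> simp [stepPower, PMF.pure_apply, hx]
  | succ n ih =>
    rw [stepPower_succ_apply, stepPower_add_apply, stepPower_one,
      ← (Equiv.mulLeft x).tsum_eq fun g => stepPower ν n g * ν (g⁻¹ * x)]
    congr 1 with g
    rw [← mul_inv_rev, ih, Equiv.coe_mulLeft, mul_inv_rev, inv_mul_cancel_right, hν, mul_comm]

open scoped Classical in
/-- The products of length at most `2 * n + 1` in two involutions. -/
noncomputable def dihedralBall (a b : G) (n : ℕ) : Finset G :=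
  (Finset.Icc (-n : ℤ) n).image (fun k => (a * b) ^ k) ∪
    (Finset.Icc (-n : ℤ) n).image (fun k => (a * b) ^ k * a)

theorem mem_dihedralBall {a b : G} {n : ℕ} {x : G} :
    x ∈ dihedralBall a b n ↔
      ∃ k : ℤ, -n ≤ k ∧ k ≤ n ∧ (x = (a * b) ^ k ∨ x = (a * b) ^ k * a) := by
  simp only [dihedralBall, Finset.mem_union, Finset.mem_image, Finset.mem_Icc]
  constructor
  · rintro (⟨k, hk, rfl⟩ | ⟨k, hk, rfl⟩)
    · exact ⟨k, hk.1, hk.2, Or.inl rfl⟩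
    · exact ⟨k, hk.1, hk.2, Or.inr rfl⟩
  · rintro ⟨k, h1, h2, rfl | rfl⟩
    · exact Or.inl ⟨k, ⟨h1, h2⟩, rfl⟩
    · exact Or.inr ⟨k, ⟨h1, h2⟩, rfl⟩

theorem card_dihedralBall_le (a b : G) (n : ℕ) : (dihedralBall a b n).card ≤ 4 * n + 2 := by
  classical
  refine (Finset.card_union_le _ _).trans ?_
  have h : (Finset.Icc (-n : ℤ) n).card = 2 * n + 1 := by
    rw [Int.card_Icc]; omega
  have h1 := Finset.card_image_le (s := Finset.Icc (-n : ℤ) n) (f := fun k : ℤ => (a * b) ^ k)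
  have h2 := Finset.card_image_le (s := Finset.Icc (-n : ℤ) n) (f := fun k : ℤ => (a * b) ^ k * a)
  omega

theorem mul_mem_dihedralBall {a b : G} (ha : a * a = 1) (hb : b * b = 1) {n : ℕ} {x s : G}
    (hx : x ∈ dihedralBall a b n) (hs : s = 1 ∨ s = a ∨ s = b) :
    x * s ∈ dihedralBall a b (n + 1) := by
  obtain ⟨k, h1, h2, hx⟩ := mem_dihedralBall.1 hx
  rw [mem_dihedralBall]
  push_cast
  rcases hs with rfl | rfl | rfl
  · exact ⟨k, by omega, by omega, by simpa using hx⟩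
  · refine ⟨k, by omega, by omega, ?_⟩
    rcases hx with rfl | rfl
    · exact Or.inr rfl
    · exact Or.inl (by rw [mul_assoc, ha, mul_one])
  · rcases hx with rfl | rfl
    · refine ⟨k - 1, by omega, by omega, Or.inr ?_⟩
      rw [zpow_sub_one, mul_assoc, mul_inv_rev, mul_assoc, inv_mul_cancel, mul_one,
        inv_eq_of_mul_eq_one_left hb]
    · exact ⟨k + 1, by omega, by omega, Or.inl (by rw [zpow_add_one, mul_assoc])⟩

theorem mem_dihedralBall_of_stepPower_ne_zero {a b : G} (ha : a * a = 1) (hb : b * b = 1)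
    {ν : PMF G} (hν : ∀ x, ν x ≠ 0 → x = 1 ∨ x = a ∨ x = b) {n : ℕ} {x : G}
    (hx : stepPower ν n x ≠ 0) : x ∈ dihedralBall a b n := by
  induction n generalizing x with
  | zero =>
    have : x = 1 := by
      by_contra h
      simp [stepPower, h] at hx
    exact mem_dihedralBall.2 ⟨0, by simp, by simp, Or.inl (by simpa using this)⟩
  | succ n ih =>
    rw [stepPower_add_apply, stepPower_one, Ne, ENNReal.tsum_eq_zero, not_forall] at hx
    obtain ⟨g, hg⟩ := hx
    rw [mul_eq_zero, not_or] at hg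
    rw [← mul_inv_cancel_left g x]
    exact mul_mem_dihedralBall ha hb (ih hg.1) (hν _ hg.2)

theorem one_le_card_mul_stepPower {a b : G} (ha : a * a = 1) (hb : b * b = 1)
    {ν : PMF G} (hν : ∀ x, ν x ≠ 0 → x = 1 ∨ x = a ∨ x = b) (n : ℕ) :
    1 ≤ (4 * n + 2) * (stepPower ν (n + n) 1).toReal := by
  have hsymm : ∀ x, ν x⁻¹ = ν x := fun x => by
    have key : ∀ {y}, ν y ≠ 0 → y⁻¹ = y := fun {y} hy => by
      rcases hν y hy with rfl | rfl | rfl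
      · exact inv_one
      · exact inv_eq_of_mul_eq_one_left ha
      · exact inv_eq_of_mul_eq_one_left hb
    by_cases hx : ν x = 0
    · by_cases hx' : ν x⁻¹ = 0
      · rw [hx, hx']
      · rw [← key hx', inv_inv]
    · rw [key hx]
  set S := dihedralBall a b n
  have hsum : ∑ x ∈ S, (stepPower ν n x).toReal = 1 := by
    rw [← ENNReal.toReal_sum fun x _ => (stepPower ν n).apply_ne_top x,
      ← ENNReal.toReal_one, ← (stepPower ν n).tsum_coe, tsum_eq_sum]
    intro x hx
    by_contra h
    exact hx (mem_dihedralBall_of_stepPower_ne_zero ha hb hν h)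
  have hsq : ∑ x ∈ S, (stepPower ν n x).toReal ^ 2 ≤ (stepPower ν (n + n) 1).toReal := by
    have : ∑ x ∈ S, stepPower ν n x ^ 2 ≤ stepPower ν (n + n) 1 := by
      rw [stepPower_add_apply]
      refine le_trans (Finset.sum_le_sum fun x _ => ?_) (ENNReal.sum_le_tsum S)
      rw [mul_one, stepPower_inv hsymm, pow_two]
    have h2 := ENNReal.toReal_mono ((stepPower ν (n + n)).apply_ne_top 1) this
    rw [ENNReal.toReal_sum fun x _ => ENNReal.pow_ne_top ((stepPower ν n).apply_ne_top x)] at h2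
    simpa using h2
  have hcs := sq_sum_le_card_mul_sum_sq (s := S) (f := fun x => (stepPower ν n x).toReal)
  rw [hsum, one_pow] at hcs
  have hcard : (S.card : ℝ) ≤ 4 * n + 2 := by exact_mod_cast card_dihedralBall_le a b n
  exact hcs.trans (mul_le_mul hcard hsq (Finset.sum_nonneg fun _ _ => sq_nonneg _) (by positivity))

theorem tsum_stepPower_eq_top_of_involutions {a b : G} (ha : a * a = 1) (hb : b * b = 1)
    {ν : PMF G} (hν : ∀ x, ν x ≠ 0 → x = 1 ∨ x = a ∨ x = b) :
    ∑' n, stepPower ν n 1 = ∞ := by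
  by_contra hfin
  have hle : ∑' n, stepPower ν (n + n) 1 ≤ ∑' n, stepPower ν n 1 :=
    ENNReal.tsum_comp_le_tsum_of_injective (f := fun n : ℕ => n + n)
      (fun m n h => by simp only at h; omega) fun n => stepPower ν n 1
  have hs := ENNReal.summable_toReal (ne_top_of_le_ne_top hfin hle)
  refine Real.not_summable_one_div_natCast ((summable_nat_add_iff 1).1 ?_)
  refine Summable.of_nonneg_of_le (fun n => by positivity) (fun n => ?_) (hs.mul_left 4)
  have h1 := one_le_card_mul_stepPower ha hb hν n
  rw [div_le_iff₀ (by positivity)]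
  push_cast
  nlinarith [ENNReal.toReal_nonneg (a := stepPower ν (n + n) 1)]

theorem pow_stepPower_le (μ : PMF G) (n k : ℕ) (x : G) :
    stepPower μ n x ^ k ≤ stepPower μ (k * n) (x ^ k) := by
  induction k with
  | zero => simp [stepPower]
  | succ k ih =>
    rw [pow_succ, pow_succ, Nat.succ_mul]
    exact (mul_le_mul_left ih _).trans (mul_stepPower_le μ _ _ _ _)

theorem tsum_stepPower_eq_top_of_map {K : Type*} [Group K] (f : G →* K)
    (hker : (f.ker : Set G).Finite) {μ : PMF G} (h : ∑' n, stepPower (μ.map f) n 1 = ∞) :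
    ∑' n, stepPower μ n 1 = ∞ := by
  classical
  have hmap : ∀ n, stepPower (μ.map f) n 1 = ∑ x ∈ hker.toFinset, stepPower μ n x := fun n => by
    rw [stepPower_map, PMF.map_apply, tsum_eq_sum (s := hker.toFinset)]
    · refine Finset.sum_congr rfl fun x hx => if_pos ?_
      simpa [eq_comm] using hx
    · intro x hx
      refine if_neg fun h1 => hx ?_
      simpa using h1.symm
  simp_rw [hmap] at h
  rw [Summable.tsum_finsetSum fun _ _ => ENNReal.summable, ENNReal.sum_eq_top] at h
  obtain ⟨x, hx, hxtop⟩ := h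
  have hfinord : IsOfFinOrder x := by
    have : Finite f.ker := hker
    have hx' : x ∈ f.ker := by simpa using hx
    exact f.ker.subtype.isOfFinOrder (isOfFinOrder_of_finite (⟨x, hx'⟩ : f.ker))
  obtain ⟨n, hn⟩ : ∃ n, stepPower μ n x ≠ 0 := by
    by_contra! h0
    simp [h0] at hxtop
  set m := (orderOf x - 1) * n with hm
  have hm0 : stepPower μ m (x ^ (orderOf x - 1)) ≠ 0 := fun h0 =>
    pow_ne_zero _ hn (le_zero_iff.1 ((pow_stepPower_le μ n (orderOf x - 1) x).trans h0.le))
  rw [← top_le_iff]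
  calc ∞ = (∑' l, stepPower μ l x) * stepPower μ m (x ^ (orderOf x - 1)) := by
        rw [hxtop, ENNReal.top_mul hm0]
    _ = ∑' l, stepPower μ l x * stepPower μ m (x ^ (orderOf x - 1)) := ENNReal.tsum_mul_right.symm
    _ ≤ ∑' l, stepPower μ (l + m) 1 := ENNReal.tsum_le_tsum fun l => by
        refine (mul_stepPower_le μ l m _ _).trans_eq ?_
        rw [← pow_succ', Nat.sub_add_cancel hfinord.orderOf_pos, pow_orderOf_eq_one]
    _ ≤ ∑' l, stepPower μ l 1 := ENNReal.tsum_comp_le_tsum_of_injective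
        (add_left_injective m) fun l => stepPower μ l 1

end Dihedral

end RandomWalk

/-! ### Amalgamated products -/

namespace Monoid.PushoutI

variable {ι H : Type*} {Γ : ι → Type*} [Group H] [∀ i, Group (Γ i)] {φ : ∀ i, H →* Γ i}

theorem countable [Countable ι] [Nonempty ι] [∀ i, Countable (Γ i)] : Countable (PushoutI φ) := by
  have : Countable (FreeMonoid (Σ i, Γ i)) := inferInstanceAs (Countable (List (Σ i, Γ i)))
  refine Function.Surjective.countable
    (f := FreeMonoid.lift fun p : Σ i, Γ i => (of p.1 p.2 : PushoutI φ)) fun x => ?_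
  induction x using PushoutI.induction_on with
  | of i g => exact ⟨FreeMonoid.of ⟨i, g⟩, by simp⟩
  | base h =>
    obtain ⟨i⟩ := ‹Nonempty ι›
    exact ⟨FreeMonoid.of ⟨i, φ i h⟩, by simp [of_apply_eq_base]⟩
  | mul x y hx hy =>
    obtain ⟨u, rfl⟩ := hx
    obtain ⟨v, rfl⟩ := hy
    exact ⟨u * v, map_mul _ _ _⟩

theorem normal_range_base (hindex : ∀ i, (φ i).range.index = 2) : (base φ).range.Normal := by
  refine ⟨fun n hn g => ?_⟩
  induction g using PushoutI.induction_on generalizing n with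
  | of i g =>
    obtain ⟨h, rfl⟩ := hn
    have := Subgroup.normal_of_index_eq_two (hindex i)
    obtain ⟨h', hh'⟩ := this.conj_mem (φ i h) ⟨h, rfl⟩ g
    exact ⟨h', by rw [← of_apply_eq_base φ i, ← of_apply_eq_base φ i, hh']; simp⟩
  | base h => exact Subgroup.mul_mem _ (Subgroup.mul_mem _ ⟨h, rfl⟩ hn) (Subgroup.inv_mem _ ⟨h, rfl⟩)
  | mul x y hx hy =>
    have := hx _ (hy n hn)
    simpa [mul_assoc] using this

theorem exists_involution_of_index_eq_two [(base φ).range.Normal] {i : ι}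
    (hi : (φ i).range.index = 2) :
    ∃ a : PushoutI φ ⧸ (base φ).range, a * a = 1 ∧
      ∀ g : Γ i, QuotientGroup.mk' (base φ).range (of i g) = 1 ∨
        QuotientGroup.mk' (base φ).range (of i g) = a := by
  obtain ⟨x, hx, hxall⟩ := Subgroup.index_eq_two_iff_exists_notMem_and.1 hi
  have hone : ∀ g ∈ (φ i).range, QuotientGroup.mk' (base φ).range (of i g) = 1 := by
    rintro _ ⟨h, rfl⟩
    rw [of_apply_eq_base]
    exact (QuotientGroup.eq_one_iff _).2 ⟨h, rfl⟩
  have hxx : QuotientGroup.mk' (base φ).range (of i x) * QuotientGroup.mk' (base φ).range (of i x) =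
      1 := by
    rw [← map_mul, ← map_mul]
    exact hone _ ((hxall x).resolve_right hx)
  refine ⟨_, hxx, fun g => ?_⟩
  rcases hxall g with hg | hg
  · have := hone _ hg
    rw [map_mul, map_mul] at this
    exact Or.inr (mul_right_cancel (this.trans hxx.symm))
  · exact Or.inl (hone _ hg)

end Monoid.PushoutI

section AmalgamStep

variable {r : ℕ} {H : Type*} [Group H] {Γ : Fin r → Type*} [∀ i, Group (Γ i)]
  {φ : ∀ i, H →* Γ i} {α : PMF (Fin r)} {μ : ∀ i, PMF (Γ i)}

theorem exists_of_mem_support_amalgamStep {x : Monoid.PushoutI φ}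
    (hx : x ∈ (amalgamStep φ α μ).support) : ∃ i, ∃ g : Γ i, Monoid.PushoutI.of i g = x := by
  simp only [amalgamStep, PMF.mem_support_bind_iff, PMF.mem_support_map_iff] at hx
  obtain ⟨i, -, g, -, h⟩ := hx
  exact ⟨i, g, h⟩

theorem finite_support_amalgamStep [∀ i, Finite (Γ i)] :
    (amalgamStep φ α μ).support.Finite := by
  refine (Set.finite_range fun p : Σ i, Γ i => (Monoid.PushoutI.of p.1 p.2 :
    Monoid.PushoutI φ)).subset fun x hx => ?_
  obtain ⟨i, g, rfl⟩ := exists_of_mem_support_amalgamStep hx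
  exact ⟨⟨i, g⟩, rfl⟩

theorem tsum_stepPower_amalgamStep_eq_top [Finite H] (hr : r = 2)
    (hindex : ∀ i, (φ i).range.index = 2) :
    ∑' n, RandomWalk.stepPower (amalgamStep φ α μ) n 1 = ∞ := by
  subst hr
  have := Monoid.PushoutI.normal_range_base hindex
  obtain ⟨a, ha, hga⟩ := Monoid.PushoutI.exists_involution_of_index_eq_two (hindex 0)
  obtain ⟨b, hb, hgb⟩ := Monoid.PushoutI.exists_involution_of_index_eq_two (hindex 1)
  refine RandomWalk.tsum_stepPower_eq_top_of_map
    (QuotientGroup.mk' (Monoid.PushoutI.base φ).range) ?_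
    (RandomWalk.tsum_stepPower_eq_top_of_involutions ha hb fun q hq => ?_)
  · rw [QuotientGroup.ker_mk']
    exact Set.finite_range (Monoid.PushoutI.base φ)
  · obtain ⟨x, hx, rfl⟩ := (PMF.mem_support_map_iff _ _ _).1 ((PMF.mem_support_iff _ _).2 hq)
    obtain ⟨i, g, rfl⟩ := exists_of_mem_support_amalgamStep hx
    fin_cases i
    · rcases hga g with h | h
      · exact Or.inl h
      · exact Or.inr (Or.inl h)
    · rcases hgb g with h | h
      · exact Or.inl h
      · exact Or.inr (Or.inr h)

end AmalgamStep

theorem mainTheorem6 (r : ℕ) (hr : 2 ≤ r)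
    {H : Type*} [Group H] [Finite H]
    {Γ : Fin r → Type*} [∀ i, Group (Γ i)] [∀ i, Finite (Γ i)]
    (φ : ∀ i, H →* Γ i) (hφ : ∀ i, Function.Injective (φ i))
    (hindex : ∀ i, 2 ≤ (φ i).range.index)
    (α : PMF (Fin r)) (hα : ∀ i, 0 < α i)
    (μ : ∀ i, PMF (Γ i)) :
    (Subgroup.closure (amalgamStep φ α μ).support = ⊤ →
      (RandomWalk.IsRecurrent (amalgamStep φ α μ) ↔
        r = 2 ∧ ∀ i, (φ i).range.index = 2)) ∧
    ((r = 2 ∧ ∀ i, (φ i).range.index = 2) →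
      RandomWalk.IsRecurrent (amalgamStep φ α μ)) ∧
    (¬ (r = 2 ∧ ∀ i, (φ i).range.index = 2) →
      ¬ IsAmenableGroup (Monoid.PushoutI φ) ∧
      (Subgroup.closure (amalgamStep φ α μ).support = ⊤ →
        RandomWalk.IsTransient (amalgamStep φ α μ))) := by
  have : Nonempty (Fin r) := ⟨⟨0, by omega⟩⟩
  have : Countable (Monoid.PushoutI φ) := Monoid.PushoutI.countable
  have hrec : (r = 2 ∧ ∀ i, (φ i).range.index = 2) →
      RandomWalk.IsRecurrent (amalgamStep φ α μ) := fun h =>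
    (RandomWalk.isRecurrent_iff _).2 (tsum_stepPower_amalgamStep_eq_top h.1 h.2)
  have htrans : ¬ (r = 2 ∧ ∀ i, (φ i).range.index = 2) →
      Subgroup.closure (amalgamStep φ α μ).support = ⊤ →
        ¬ RandomWalk.IsRecurrent (amalgamStep φ α μ) := fun h hgen => by
    obtain ⟨B, x, y, z, hB⟩ :=
      Monoid.PushoutI.exists_isParadoxical_of_not_dihedral hr hφ hindex h
    rw [RandomWalk.isRecurrent_iff]
    exact (RandomWalk.tsum_stepPower_one_lt_top hB _ finite_support_amalgamStep hgen).ne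
  refine ⟨fun hgen => ⟨fun h => ?_, hrec⟩, hrec, fun h => ⟨?_, fun hgen => ?_⟩⟩
  · by_contra hnot
    exact htrans hnot hgen h
  · obtain ⟨B, x, y, z, hB⟩ :=
      Monoid.PushoutI.exists_isParadoxical_of_not_dihedral hr hφ hindex h
    exact hB.not_isAmenableGroup
  · exact (RandomWalk.isTransient_iff_not_isRecurrent _).2 (htrans h hgen)
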